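/- For a permutation $\pi=\pi_1\pi_2\cdots\pi_n$ of $[n]=\{1,\dots,n\}$ put $\pi_0=0$. An index $1\le i\le n-1$ is an exterior peak if $\pi_{i-1}<\pi_i>\pi_{i+1}$; it is of pattern 132 if $\pi_{i-1}<\pi_{i+1}$ and of pattern 231 if $\pi_{i-1}>\pi_{i+1}$. The permutation is alternating (down-up) if $\pi_1>\pi_2<\pi_3>\pi_4<\cdots$. For $n\ge 0$ let $T^A(n,i,j)$ be the number of alternating permutations of $[n]$ with $i$ exterior peaks of pattern 132 and $j$ exterior peaks of pattern 231, let $E_n$ be the number of all alternating permutations of $[n]$, and let $T^A_n(x,y)=\sum_{i,j\ge 0}T^A(n,i,j)x^iy^j$. Let ${}_1F_1(a;b;z)=\sum_{n\ge 0}\frac{(a)_n}{(b)_n}\frac{z^n}{n!}$, where $(a)_n=a(a+1)\cdots(a+n-1)$ and $(a)_0=1$. Then, as an identity of formal power series in $t$, for all $x\ne y$ in a field of characteristic $0$ (in particular for indeterminates $x,y$), $$\sum_{n=0}^\infty T^A_n(x,y)\frac{t^n}{n!}=\frac{e^{\frac{x-y}{2}t^2}\left(1+t\,{}_1F_1\!\left(\frac{x}{2(x-y)};\frac32;-\frac{x-y}{2}t^2\right)\right)}{{}_1F_1\!\left(-\frac{y}{2(x-y)};\frac12;\frac{x-y}{2}t^2\right)}.$$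 Moreover, $T^A_n(1,1)=E_n$ for all $n$; for complex $x\neq y$ with $(x,y)\to(1,1)$ the right-hand side tends, coefficient by coefficient in $t$, to $\sec t+\tan t$; and $\sum_{n=0}^\infty E_n\frac{t^n}{n!}=\sec t+\tan t$. -/

import Mathlib

open scoped Nat Topology

namespace AltPeaks

/-- The word `π₁ π₂ ⋯ πₙ` (entries in `{1, …, n}`) of a permutation of an `n`-element set, as a
function of the index `i`; outside `1 ≤ i ≤ n` the value is `0`, in particular `π₀ = 0`. -/
def word {n : ℕ} (σ : Equiv.Perm (Fin n)) (i : ℕ) : ℕ :=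
  if h : 1 ≤ i ∧ i ≤ n then (σ ⟨i - 1, by omega⟩ : ℕ) + 1 else 0

/-- `i` is an exterior peak: `1 ≤ i ≤ n - 1` and `πᵢ₋₁ < πᵢ > πᵢ₊₁`, with `π₀ = 0`. -/
def IsExteriorPeak {n : ℕ} (σ : Equiv.Perm (Fin n)) (i : ℕ) : Prop :=
  (1 ≤ i ∧ i + 1 ≤ n) ∧ word σ (i - 1) < word σ i ∧ word σ (i + 1) < word σ i

/-- The number of exterior peaks of pattern 132, i.e. those with `πᵢ₋₁ < πᵢ₊₁`. -/
noncomputable def ep132 {n : ℕ} (σ : Equiv.Perm (Fin n)) : ℕ :=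
  {i : ℕ | IsExteriorPeak σ i ∧ word σ (i - 1) < word σ (i + 1)}.ncard

/-- The number of exterior peaks of pattern 231, i.e. those with `πᵢ₋₁ > πᵢ₊₁`. -/
noncomputable def ep231 {n : ℕ} (σ : Equiv.Perm (Fin n)) : ℕ :=
  {i : ℕ | IsExteriorPeak σ i ∧ word σ (i + 1) < word σ (i - 1)}.ncard

/-- Alternating (down-up) permutations: `π₁ > π₂ < π₃ > π₄ < ⋯`. -/
def IsAlternating {n : ℕ} (σ : Equiv.Perm (Fin n)) : Prop :=
  ∀ i : ℕ, 1 ≤ i → i + 1 ≤ n →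
    (Odd i → word σ (i + 1) < word σ i) ∧ (Even i → word σ i < word σ (i + 1))

/-- The number of alternating permutations on `[n]` with `i` exterior peaks of pattern 132 and
`j` exterior peaks of pattern 231. -/
noncomputable def altCount (n i j : ℕ) : ℕ :=
  {σ : Equiv.Perm (Fin n) | IsAlternating σ ∧ ep132 σ = i ∧ ep231 σ = j}.ncard

/-- The Euler number: the number of alternating permutations on `[n]`. -/
noncomputable def eulerNumber (n : ℕ) : ℕ :=
  {σ : Equiv.Perm (Fin n) | IsAlternating σ}.ncard

/-- `T^A_n(x, y) = ∑_{i, j ≥ 0} T^A(n, i, j) xⁱ yʲ`. A permutation on `[n]` has at most `n`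
exterior peaks, so the sum over `0 ≤ i, j ≤ n` is the whole sum. -/
noncomputable def altPoly {K : Type*} [Field K] (n : ℕ) (x y : K) : K :=
  ∑ i ∈ Finset.range (n + 1), ∑ j ∈ Finset.range (n + 1), (altCount n i j : K) * x ^ i * y ^ j

/-- The confluent hypergeometric series `₁F₁(a; b; z) = ∑ (a)ₙ / (b)ₙ zⁿ / n!`, as a formal power
series in `z`. -/
noncomputable def oneFone {K : Type*} [Field K] (a b : K) : PowerSeries K :=
  PowerSeries.mk fun n =>
    (ascPochhammer K n).eval a / (ascPochhammer K n).eval b * (1 / (n ! : K))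

/-- The monomial `c t²`. -/
noncomputable def sqTerm {K : Type*} [Field K] (c : K) : PowerSeries K :=
  PowerSeries.C c * PowerSeries.X ^ 2

/-- The formal power series in `t`
`e^{(x-y)t²/2} (1 + t ₁F₁(x/(2(x-y)); 3/2; -(x-y)t²/2)) / ₁F₁(-y/(2(x-y)); 1/2; (x-y)t²/2)`.
The denominator has constant coefficient `1`. -/
noncomputable def closedForm {K : Type*} [Field K] [CharZero K] (x y : K) : PowerSeries K :=
  (PowerSeries.exp K).subst (sqTerm ((x - y) / 2)) *
    (1 + PowerSeries.X *
      (oneFone (x / (2 * (x - y))) (3 / 2)).subst (sqTerm (-((x - y) / 2)))) *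
    ((oneFone (-(y / (2 * (x - y)))) (1 / 2)).subst (sqTerm ((x - y) / 2)))⁻¹

end AltPeaks

namespace AltPeaks

open PowerSeries

/-! ### Formal differential equations and the confluent hypergeometric series. -/

section Series

variable {K : Type*} [Field K]

/-! Cut an alternating permutation of `[n+1]`, n ≥ 1, at its letter 1. The prefix has odd length k,
and the letter just before 1 is the only exterior peak not visible inside the two pieces: of pattern
132 if k = 1, its left neighbour being π₀ = 0, and of pattern 231 otherwise. For the suffix the
letter 1 plays the role of π₀. This gives a binomial convolution for T_{n+1} (`totalWeight_succ`).

Let G be the exponential generating function and O its odd part. The convolution reads G' = 1 + HG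
and O' = 1 + HO with H = yO + (x-y)t. The second equation is of Riccati type and is linearised by O
= P/P', where P'' + (x-y)tP' + yP = 0, P(0) = 0, P'(0) = 1; then G = (1+P)/P'
(`eq_one_add_mul_inv_of_derivative`, `mk_altPoly_eq`).

For x ≠ y, a substitution z = ct² turns the linear equation into Kummer's (`oneFone_kummer`), and
`closedForm_eq` identifies (1+P)/P' with the stated quotient. The description by P also makes sense
for x = y: at x = y = 1 it gives P = sin, hence sec + tan. The limit is then just continuity of the
polynomials T_n. -/

theorem hasSubst_sqTerm (c : K) : HasSubst (sqTerm c) :=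
  HasSubst.of_constantCoeff_zero' (by simp [sqTerm])

theorem derivative_sqTerm (c : K) : d⁄dX K (sqTerm c) = C (2 * c) * X := by
  simp only [sqTerm, Derivation.leibniz, derivative_pow, derivative_X, derivative_C, smul_eq_mul,
    map_mul, map_ofNat]
  simp
  ring

theorem constantCoeff_subst_sqTerm (f : PowerSeries K) (c : K) :
    constantCoeff (f.subst (sqTerm c)) = constantCoeff f := by
  have h := constantCoeff_subst_eq_zero (a := sqTerm c)
    (show constantCoeff (sqTerm c) = 0 by simp [sqTerm])
    (f - C (constantCoeff f)) (by simp)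
  rw [subst_sub (hasSubst_sqTerm c), subst_C, map_sub, sub_eq_zero] at h
  exact h.trans (MvPowerSeries.constantCoeff_C _)

variable [CharZero K]

/-- A homogeneous linear differential equation of first order has only the zero solution with
vanishing constant coefficient. -/
theorem eq_zero_of_derivative_eq_mul {f h : PowerSeries K} (hf : d⁄dX K f = h * f)
    (h0 : constantCoeff f = 0) : f = 0 := by
  have key : ∀ n, coeff n f = 0 := by
    intro n
    induction n using Nat.strong_induction_on with
    | _ n ih =>
      cases n with
      | zero => simpa using h0
      | succ n =>
        have h1 := congrArg (coeff n) hf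
        rw [coeff_derivative, coeff_mul, Finset.sum_eq_zero] at h1
        · have h2 : (n : K) + 1 ≠ 0 := by exact_mod_cast n.succ_ne_zero
          exact (mul_eq_zero.mp h1).resolve_right h2
        · intro p hp
          have := Finset.HasAntidiagonal.mem_antidiagonal.mp hp
          rw [ih p.2 (by omega), mul_zero]
  ext n
  simpa using key n

/-- A homogeneous linear differential equation of second order has only the zero solution whose
coefficients of degree `0` and `1` vanish. -/
theorem eq_zero_of_derivative_derivative_eq {f g h : PowerSeries K}
    (hf : d⁄dX K (d⁄dX K f) = g * d⁄dX K f + h * f)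
    (h0 : constantCoeff f = 0) (h1 : constantCoeff (d⁄dX K f) = 0) : f = 0 := by
  have key : ∀ n, coeff n f = 0 := by
    intro n
    induction n using Nat.strong_induction_on with
    | _ n ih =>
      match n with
      | 0 => simpa using h0
      | 1 =>
        rw [← coeff_zero_eq_constantCoeff_apply, coeff_derivative] at h1
        simpa using h1
      | n + 2 =>
        have e := congrArg (coeff n) hf
        rw [coeff_derivative, coeff_derivative, map_add, coeff_mul, coeff_mul,
          Finset.sum_eq_zero, Finset.sum_eq_zero, add_zero] at e
        · have h2 : (n : K) + 1 ≠ 0 := by exact_mod_cast n.succ_ne_zero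
          have h3 : ((n + 1 : ℕ) : K) + 1 ≠ 0 := by exact_mod_cast (n + 1).succ_ne_zero
          exact (mul_eq_zero.mp ((mul_eq_zero.mp e).resolve_right h2)).resolve_right h3
        · intro p hp
          have := Finset.HasAntidiagonal.mem_antidiagonal.mp hp
          rw [ih p.2 (by omega), mul_zero]
        · intro p hp
          have := Finset.HasAntidiagonal.mem_antidiagonal.mp hp
          rw [coeff_derivative, ih (p.2 + 1) (by omega), zero_mul, mul_zero]
  ext n
  simpa using key n

/-- The solution of the system `O' = 1 + (yO + (x-y)t) O`, `G' = 1 + (yO + (x-y)t) G` in terms of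
a solution of `P'' + (x-y)t P' + y P = 0`. -/
theorem eq_one_add_mul_inv_of_derivative {x y : K} {G O N P : PowerSeries K}
    (hG : d⁄dX K G = 1 + (C y * O + C (x - y) * X) * G) (hG0 : constantCoeff G = 1)
    (hO : d⁄dX K O = 1 + (C y * O + C (x - y) * X) * O) (hO0 : constantCoeff O = 0)
    (hP : d⁄dX K P = N) (hP0 : constantCoeff P = 0)
    (hN : d⁄dX K N = -(C (x - y) * X * N) - C y * P) (hN0 : constantCoeff N = 1) :
    G = (1 + P) * N⁻¹ := by
  have hN1 : N * N⁻¹ = 1 := PowerSeries.mul_inv_cancel N (by rw [hN0]; exact one_ne_zero)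
  have hO' : O = P * N⁻¹ := by
    have : O - P * N⁻¹ = 0 := by
      -- The difference of two solutions of a Riccati equation solves a linear one, since O² - Q² =
      -- (O + Q)(O - Q), here with Q = P/N.
      apply eq_zero_of_derivative_eq_mul (h := C y * (O + P * N⁻¹) + C (x - y) * X)
      · simp only [map_sub, Derivation.leibniz, derivative_inv', smul_eq_mul, hO, hP, hN]
        linear_combination (-1 - (C x - C y) * X * P * N⁻¹) * hN1
      · simp [hO0, hP0]
    exact sub_eq_zero.mp this
  have : G - (1 + P) * N⁻¹ = 0 := by
    apply eq_zero_of_derivative_eq_mul (h := C y * O + C (x - y) * X)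
    · simp only [map_sub, map_add, derivative_one, Derivation.leibniz, derivative_inv',
        smul_eq_mul, hG, hP, hN, hO']
      linear_combination (-1 - (C x - C y) * X * (1 + P) * N⁻¹) * hN1
    · simp [hG0, hP0, hN0]
  exact sub_eq_zero.mp this

/-- Kummer's differential equation `z w'' + (b - z) w' - a w = 0`. -/
theorem oneFone_kummer (a b : K) (hb : ∀ k : ℕ, b + k ≠ 0) :
    X * d⁄dX K (d⁄dX K (oneFone a b)) + (C b - X) * d⁄dX K (oneFone a b) =
      C a * oneFone a b := by
  have hasc : ∀ n : ℕ, (ascPochhammer K n).eval b ≠ 0 := by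
    intro n h
    obtain ⟨k, -, hk⟩ := (ascPochhammer_eval_eq_zero_iff n b).mp h
    exact hb k (by rw [hk]; ring)
  have hrec : ∀ n : ℕ, coeff (n + 1) (oneFone a b) * ((n : K) + 1) * (b + n) =
      coeff n (oneFone a b) * (a + n) := by
    intro n
    have h1 : (n : K) + 1 ≠ 0 := by exact_mod_cast n.succ_ne_zero
    have h2 : (n ! : K) ≠ 0 := by exact_mod_cast n.factorial_ne_zero
    simp only [oneFone, coeff_mk, ascPochhammer_succ_eval, Nat.factorial_succ, Nat.cast_mul,
      Nat.cast_add, Nat.cast_one]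
    have := hasc n
    have := hb n
    field_simp
  -- On coefficients, Kummer's equation is exactly the two-term recurrence `hrec`.
  ext n
  cases n with
  | zero =>
    have := hrec 0
    simp only [sub_mul, map_add, map_sub, coeff_C_mul, coeff_zero_X_mul, coeff_derivative]
    push_cast at this ⊢
    linear_combination this
  | succ n =>
    have := hrec (n + 1)
    simp only [sub_mul, map_add, map_sub, coeff_C_mul, coeff_succ_X_mul, coeff_derivative]
    push_cast at this ⊢
    linear_combination this

theorem constantCoeff_oneFone (a b : K) : constantCoeff (oneFone a b) = 1 := by
  rw [← coeff_zero_eq_constantCoeff_apply]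
  simp [oneFone]

/-- Keeps the denominators (b)ₙ nonzero for b = 1/2 and b = 3/2. -/
theorem half_add_natCast_ne_zero (m k : ℕ) : ((2 * m + 1 : ℕ) : K) / 2 + k ≠ 0 := by
  have h : ((2 * m + 1 + 2 * k : ℕ) : K) ≠ 0 := by
    rw [Nat.cast_ne_zero]; omega
  intro h'
  apply h
  push_cast at h' ⊢
  linear_combination 2 * h'

/-- The closed form is `(1 + P) / P'` for a solution `P` of `P'' + (x-y)t P' + y P = 0`. -/
theorem closedForm_eq (x y : K) (hxy : x ≠ y) :
    ∃ N P : PowerSeries K, d⁄dX K P = N ∧ constantCoeff P = 0 ∧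
      d⁄dX K N = -(C (x - y) * X * N) - C y * P ∧ constantCoeff N = 1 ∧
      closedForm x y = (1 + P) * N⁻¹ := by
  have hxy' : x - y ≠ 0 := sub_ne_zero.mpr hxy
  set c : K := (x - y) / 2 with hc
  set a : K := -(y / (2 * (x - y))) with ha
  set a' : K := x / (2 * (x - y)) with ha'
  have hac : 4 * c * a = -y := by rw [hc, ha]; field_simp; ring
  have hac' : 4 * c * a' = x := by rw [hc, ha']; field_simp; ring
  have hc2 : 2 * c = x - y := by rw [hc]; ring
  set E : PowerSeries K := (PowerSeries.exp K).subst (sqTerm c) with hE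
  set M : PowerSeries K := (oneFone a (1 / 2)).subst (sqTerm c) with hM
  set g : PowerSeries K := (oneFone a' (3 / 2)).subst (sqTerm (-c)) with hg
  have hDE : d⁄dX K E = C (2 * c) * X * E := by
    rw [hE, derivative_subst (hasSubst_sqTerm c), derivative_exp, derivative_sqTerm]
    ring
  have hE0 : constantCoeff E = 1 := by
    rw [hE, constantCoeff_subst_sqTerm, constantCoeff_exp]
  have hM0 : constantCoeff M = 1 := by
    rw [hM, constantCoeff_subst_sqTerm, constantCoeff_oneFone]
  have hg0 : constantCoeff g = 1 := by
    rw [hg, constantCoeff_subst_sqTerm, constantCoeff_oneFone]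
  have hDM : d⁄dX K M = (d⁄dX K (oneFone a (1 / 2))).subst (sqTerm c) * (C (2 * c) * X) := by
    rw [hM, derivative_subst (hasSubst_sqTerm c), derivative_sqTerm]
  have substX : ∀ c : K, (X : PowerSeries K).subst (sqTerm c) = C c * X ^ 2 := fun c => by
    rw [subst_X (hasSubst_sqTerm c)]; rfl
  have substC : ∀ c r : K, (C r : PowerSeries K).subst (sqTerm c) = C r := fun c r => by
    rw [subst_C]; rfl
  have hDDM : d⁄dX K (d⁄dX K M) = C (2 * c) * X * d⁄dX K M + C (-y) * M := by
    have hk := congrArg (fun f => f.subst (sqTerm c)) (oneFone_kummer a (1 / 2 : K) (by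
      intro k; simpa using half_add_natCast_ne_zero (K := K) 0 k))
    simp only [subst_add (hasSubst_sqTerm c), subst_mul (hasSubst_sqTerm c),
      subst_sub (hasSubst_sqTerm c), substX, substC] at hk
    rw [hDM, Derivation.leibniz, derivative_subst (hasSubst_sqTerm c), derivative_sqTerm,
      Derivation.leibniz]
    simp only [derivative_C, derivative_X, smul_eq_mul, ← hac, ← hM] at hk ⊢
    have h2 : (C (1 / 2 : K)) * 2 = (1 : PowerSeries K) := by
      rw [← map_ofNat C 2, ← map_mul]; simp
    simp only [map_mul, map_ofNat] at hk ⊢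
    -- With z = ct² and M = w(z), M'' = 4c(z w'' + w'/2), so Kummer's equation enters with factor 4c
    -- and 4ca = -y appears.
    linear_combination 4 * C c * hk - 2 * C c *
      (d⁄dX K (oneFone a (1 / 2))).subst (sqTerm c) * h2
  set P : PowerSeries K := X * g with hP
  have hDP : d⁄dX K P = g + X * ((d⁄dX K (oneFone a' (3 / 2))).subst (sqTerm (-c)) *
      (C (2 * -c) * X)) := by
    rw [hP, Derivation.leibniz, derivative_X, hg, derivative_subst (hasSubst_sqTerm (-c)),
      derivative_sqTerm]
    simp only [smul_eq_mul]
    ring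
  have hDDP : d⁄dX K (d⁄dX K P) = -(C (2 * c) * X * d⁄dX K P) - C y * P := by
    have hk := congrArg (fun f => f.subst (sqTerm (-c))) (oneFone_kummer a' (3 / 2 : K) (by
      intro k; simpa [show (2 : K) + 1 = 3 by norm_num] using
        half_add_natCast_ne_zero (K := K) 1 k))
    simp only [subst_add (hasSubst_sqTerm (-c)), subst_mul (hasSubst_sqTerm (-c)),
      subst_sub (hasSubst_sqTerm (-c)), substX, substC] at hk
    rw [hDP, map_add, Derivation.leibniz, Derivation.leibniz, hg,
      derivative_subst (hasSubst_sqTerm (-c)), derivative_subst (hasSubst_sqTerm (-c)),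
      derivative_sqTerm, Derivation.leibniz, hP]
    simp only [derivative_C, derivative_X, smul_eq_mul, ← hg] at hk ⊢
    have h2 : (C (3 / 2 : K)) * 2 = (3 : PowerSeries K) := by
      rw [← map_ofNat C 2, ← map_mul, ← map_ofNat C 3]; simp
    -- This is y = x - (x-y).
    have hy : C y = 4 * C c * C a' - (2 * C c : PowerSeries K) := by
      rw [← map_ofNat C 4, ← map_ofNat C 2, ← map_mul, ← map_mul, ← map_mul, ← map_sub, hac',
        hc2]
      congr 1; ring
    simp only [map_mul, map_ofNat, map_neg, hy] at hk ⊢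
    linear_combination -4 * C c * X * hk + 2 * C c * X *
      (d⁄dX K (oneFone a' (3 / 2))).subst (sqTerm (-c)) * h2
  have hN0 : constantCoeff (d⁄dX K P) = 1 := by simp [hDP, hg0]
  have hP0 : constantCoeff P = 0 := by simp [hP]
  have hcf : closedForm x y = E * (1 + P) * M⁻¹ := rfl
  clear_value P E M
  -- Both sides solve f'' = (x-y)t f' - y f with f(0) = 1 and f'(0) = 0. Thus the denominator of the
  -- closed form is E times P'.
  have hMEN : E * d⁄dX K P = M := by
    have h1 : d⁄dX K (E * d⁄dX K P) = -(C y * E * P) := by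
      rw [Derivation.leibniz, hDDP, hDE]
      simp only [smul_eq_mul]
      ring
    have : E * d⁄dX K P - M = 0 := by
      apply eq_zero_of_derivative_derivative_eq (g := C (2 * c) * X) (h := C (-y))
      · rw [map_sub, map_sub, hDDM, h1, map_neg, Derivation.leibniz, Derivation.leibniz, hDE]
        simp only [smul_eq_mul, derivative_C, map_neg]
        ring
      · simp [hE0, hN0, hM0]
      · rw [map_sub, h1, hDM]
        simp [hP0]
    exact sub_eq_zero.mp this
  refine ⟨d⁄dX K P, P, rfl, hP0, by rw [hDDP, hc2], hN0, ?_⟩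
  have hN1 := PowerSeries.mul_inv_cancel (d⁄dX K P) (by rw [hN0]; exact one_ne_zero)
  have hM1 := PowerSeries.mul_inv_cancel M (by rw [hM0]; exact one_ne_zero)
  rw [hcf]
  rw [← hMEN] at hM1 ⊢
  linear_combination (1 + P) * (d⁄dX K P)⁻¹ * hM1 -
    E * (1 + P) * (E * d⁄dX K P)⁻¹ * hN1

theorem derivative_sin : d⁄dX K (PowerSeries.sin K) = PowerSeries.cos K := by
  ext n
  have h1 : (n : K) + 1 ≠ 0 := by exact_mod_cast n.succ_ne_zero
  have h2 : (n ! : K) ≠ 0 := by exact_mod_cast n.factorial_ne_zero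
  rw [coeff_derivative]
  rcases Nat.even_or_odd' n with ⟨k, rfl | rfl⟩
  · simp [PowerSeries.sin, PowerSeries.cos, parity_simps, Nat.factorial_succ,
      show (2 * k + 1) / 2 = k by omega] at h1 h2 ⊢
    field_simp
  · simp [PowerSeries.sin, PowerSeries.cos, parity_simps]

theorem derivative_cos : d⁄dX K (PowerSeries.cos K) = -PowerSeries.sin K := by
  ext n
  have h1 : (n : K) + 1 ≠ 0 := by exact_mod_cast n.succ_ne_zero
  have h2 : (n ! : K) ≠ 0 := by exact_mod_cast n.factorial_ne_zero
  rw [coeff_derivative]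
  rcases Nat.even_or_odd' n with ⟨k, rfl | rfl⟩
  · simp [PowerSeries.sin, PowerSeries.cos, parity_simps]
  · simp [PowerSeries.sin, PowerSeries.cos, parity_simps, Nat.factorial_succ (2 * k + 1),
      show (2 * k + 1) / 2 = k by omega, show (2 * k + 1 + 1) / 2 = k + 1 by omega,
      pow_succ (-1 : K)] at h1 h2 ⊢
    field_simp

end Series

/-! ### Weighted words cut at their minimum. -/

section Words

variable {K : Type*} [Field K]

/-- The weight of a word `p :: l`, where `p` plays the role of `π₀`: zero unless the word goes
up-down-up-⋯, and otherwise the product of `x` over the peaks of pattern 132 and of `y` over those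
of pattern 231. -/
def weight (x y : K) : List ℕ → K
  | [] => 1
  | [_] => 1
  | [p, a] => if p < a then 1 else 0
  | p :: a :: b :: l =>
    if p < a ∧ b < a then
      (if p < b then x else if b < p then y else 1) * weight x y (b :: l)
    else 0

/-- The factor contributed by the last letter of a prefix of length `k` that is followed by the
minimum of the whole word. -/
def lastFactor (x y : K) (k : ℕ) : K :=
  if k = 1 then x else if Odd k then y else 0

/-- The letter before m must be a peak, which forces odd length. Its left neighbour, in `l₁` or
equal to p, exceeds m, so the pattern is 231. Removing two letters at the front preserves the
situation. -/
theorem weight_append_cons_of_lt_head (x y : K) (m : ℕ) (l₂ : List ℕ) :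
    ∀ (l₁ : List ℕ) (p : ℕ), m < p → (∀ a ∈ l₁, m < a) → (∀ a ∈ l₂, m < a) →
      weight x y (p :: (l₁ ++ m :: l₂)) =
        (if Odd l₁.length then y else 0) * weight x y (p :: l₁) * weight x y (m :: l₂)
  | [], p, hp, _, _ => by
    cases l₂ <;> simp [weight, hp.le]
  | [a], p, hp, h₁, _ => by
    have ha : m < a := h₁ a (by simp)
    by_cases hpa : p < a <;> simp [weight, hp, hp.le, ha, hpa]
  | a :: b :: l₁, p, hp, h₁, h₂ => by
    have ih := weight_append_cons_of_lt_head x y m l₂ l₁ b (h₁ b (by simp))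
      (fun c hc => h₁ c (by simp [hc])) h₂
    have hodd : Odd (l₁.length + 1 + 1) ↔ Odd l₁.length := by simp [parity_simps]
    simp only [List.cons_append, weight, List.length_cons, hodd, ih]
    split_ifs <;> ring

/-- Now p lies below m, so a prefix of one letter gives a peak of pattern 132; for longer prefixes
the peak before m has its left neighbour above m. The word p m must be excluded: it has weight 1,
while `lastFactor` vanishes at 0. -/
theorem weight_append_cons (x y : K) {m p : ℕ} {l₁ l₂ : List ℕ} (hp : p < m)
    (h₁ : ∀ a ∈ l₁, m < a) (h₂ : ∀ a ∈ l₂, m < a) (hne : l₁ ≠ [] ∨ l₂ ≠ []) :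
    weight x y (p :: (l₁ ++ m :: l₂)) =
      lastFactor x y l₁.length * weight x y (p :: l₁) * weight x y (m :: l₂) := by
  match l₁ with
  | [] =>
    cases l₂ with
    | nil => simp at hne
    | cons b l₂ =>
      have hb : m < b := h₂ b (by simp)
      simp [weight, lastFactor, hb.le]
  | [a] =>
    have ha : m < a := h₁ a (by simp)
    simp [weight, lastFactor, hp, ha, hp.trans ha]
  | a :: b :: l₁ =>
    have ih := weight_append_cons_of_lt_head x y m l₂ l₁ b (h₁ b (by simp))
      (fun c hc => h₁ c (by simp [hc])) h₂
    have hodd : Odd (l₁.length + 1 + 1) ↔ Odd l₁.length := by simp [parity_simps]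
    have hone : ¬ (l₁.length + 1 + 1 = 1) := by omega
    simp only [List.cons_append, weight, List.length_cons, lastFactor, hodd, hone, if_false, ih]
    split_ifs <;> ring

/-- The head enters only through comparisons with later letters; this lets m replace π₀ = 0 in front
of the suffix. -/
theorem weight_cons_congr (x y : K) {p q : ℕ} {l : List ℕ} (hp : ∀ a ∈ l, p < a)
    (hq : ∀ a ∈ l, q < a) : weight x y (p :: l) = weight x y (q :: l) := by
  match l with
  | [] => rfl
  | [a] => simp [weight, hp a (by simp), hq a (by simp)]
  | a :: b :: l =>
    simp [weight, hp a (by simp), hq a (by simp), hp b (by simp), hq b (by simp)]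

/-- The words in which every letter of `s` occurs exactly once. -/
noncomputable def arrangements (s : Finset ℕ) : Finset (List ℕ) :=
  s.toList.permutations.toFinset

theorem mem_arrangements {s : Finset ℕ} {l : List ℕ} :
    l ∈ arrangements s ↔ l.Nodup ∧ l.toFinset = s := by
  rw [arrangements, List.mem_toFinset, List.mem_permutations]
  constructor
  · intro h
    refine ⟨h.nodup_iff.mpr s.nodup_toList, ?_⟩
    rw [List.toFinset_eq_of_perm _ _ h, Finset.toList_toFinset]
  · rintro ⟨h, rfl⟩
    exact (List.perm_ext_iff_of_nodup h (Finset.nodup_toList _)).mpr (by simp)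

theorem mem_of_mem_arrangements {s : Finset ℕ} {l : List ℕ} (h : l ∈ arrangements s) {a : ℕ} :
    a ∈ l ↔ a ∈ s := by
  rw [← (mem_arrangements.mp h).2, List.mem_toFinset]

theorem length_of_mem_arrangements {s : Finset ℕ} {l : List ℕ} (h : l ∈ arrangements s) :
    l.length = s.card := by
  obtain ⟨h1, rfl⟩ := mem_arrangements.mp h
  exact (List.toFinset_card_of_nodup h1).symm

/-- An arrangement of `insert m s` is an arrangement of a subset of `s`, followed by `m` and an
arrangement of the rest. -/
theorem sum_arrangements_insert {M : Type*} [AddCommMonoid M] {m : ℕ} {s : Finset ℕ} (hm : m ∉ s)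
    (f : List ℕ → M) :
    ∑ l ∈ arrangements (insert m s), f l =
      ∑ A ∈ s.powerset, ∑ l₁ ∈ arrangements A, ∑ l₂ ∈ arrangements (s \ A),
        f (l₁ ++ m :: l₂) := by
  simp_rw [← Finset.sum_product']
  rw [Finset.sum_sigma']
  symm
  refine Finset.sum_bij (fun q _ => q.2.1 ++ m :: q.2.2) ?_ ?_ ?_ ?_
  · rintro ⟨A, l₁, l₂⟩ h
    simp only [Finset.mem_sigma, Finset.mem_powerset, Finset.mem_product] at h
    obtain ⟨hA, h₁, h₂⟩ := h
    rw [mem_arrangements] at h₁ h₂ ⊢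
    obtain ⟨n₁, rfl⟩ := h₁
    obtain ⟨n₂, e₂⟩ := h₂
    have hl₁ : ∀ a ∈ l₁, a ∈ s := fun a ha => hA (by simpa using ha)
    have hl₂ : ∀ a, a ∈ l₂ ↔ a ∈ s ∧ a ∉ l₁ := fun a => by
      rw [← List.mem_toFinset, e₂]; simp
    constructor
    · rw [List.nodup_append, List.nodup_cons]
      refine ⟨n₁, ⟨fun h => hm ((hl₂ m).mp h).1, n₂⟩, ?_⟩
      rintro a ha b hb rfl
      rcases List.mem_cons.mp hb with rfl | hb
      · exact hm (hl₁ _ ha)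
      · exact ((hl₂ a).mp hb).2 ha
    · ext a
      simp only [List.mem_toFinset, List.mem_append, List.mem_cons, hl₂, Finset.mem_insert]
      have := hl₁ a
      tauto
  · rintro ⟨A, l₁, l₂⟩ h ⟨A', l₁', l₂'⟩ h' e
    simp only [Finset.mem_sigma, Finset.mem_powerset, Finset.mem_product] at h h'
    obtain ⟨hA, h₁, h₂⟩ := h
    obtain ⟨hA', h₁', h₂'⟩ := h'
    have i₁ : m ∉ l₁ := fun hi => hm (hA ((mem_of_mem_arrangements h₁).mp hi))
    have i₂ : m ∉ l₂ := fun hi =>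
      hm (Finset.mem_sdiff.mp ((mem_of_mem_arrangements h₂).mp hi)).1
    have i₁' : m ∉ l₁' := fun hi => hm (hA' ((mem_of_mem_arrangements h₁').mp hi))
    have i₂' : m ∉ l₂' := fun hi =>
      hm (Finset.mem_sdiff.mp ((mem_of_mem_arrangements h₂').mp hi)).1
    have := List.append_cons_inj_of_notMem (x₁ := l₁) (x₂ := l₁') (z₁ := l₂) (z₂ := l₂')
      (a₁ := m) (a₂ := m) (by assumption) (by assumption)
    obtain ⟨rfl, -, rfl⟩ := this.mp e
    rw [mem_arrangements] at h₁ h₁'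
    obtain rfl := h₁.2.symm.trans h₁'.2
    rfl
  · intro l hl
    obtain ⟨l₁, l₂, rfl⟩ := List.append_of_mem ((mem_of_mem_arrangements hl).mpr
      (Finset.mem_insert_self m s))
    obtain ⟨hn, he⟩ := mem_arrangements.mp hl
    rw [List.nodup_append, List.nodup_cons] at hn
    obtain ⟨n₁, ⟨hm₂, n₂⟩, hd⟩ := hn
    have hs : ∀ a, a ∈ s ↔ a ∈ l₁ ∨ a ∈ l₂ := by
      intro a
      have h1 : a ∈ l₁ ++ m :: l₂ ↔ a ∈ insert m s := by rw [← he, List.mem_toFinset]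
      simp only [List.mem_append, List.mem_cons, Finset.mem_insert] at h1
      have h2 : a = m → a ∉ l₁ := fun h h' => hd a h' m (by simp) h
      have h3 : a = m → a ∉ s ∧ a ∉ l₂ := by rintro rfl; exact ⟨hm, hm₂⟩
      tauto
    refine ⟨⟨l₁.toFinset, l₁, l₂⟩, ?_, rfl⟩
    simp only [Finset.mem_sigma, Finset.mem_powerset, Finset.mem_product, mem_arrangements]
    refine ⟨fun a ha => (hs a).mpr (Or.inl (by simpa using ha)), ⟨n₁, trivial⟩, n₂, ?_⟩
    ext a
    have := fun h h' => hd a h a (List.mem_cons_of_mem _ h') rfl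
    simp only [List.mem_toFinset, Finset.mem_sdiff, hs]
    tauto
  · rintro ⟨A, l₁, l₂⟩ h
    rfl

/-- The total weight of the arrangements of `{1, …, n}`. -/
noncomputable def totalWeight (x y : K) (n : ℕ) : K :=
  ∑ l ∈ arrangements (Finset.Icc 1 n), weight x y (0 :: l)

theorem sum_weight_arrangements_insert (x y : K) {m p : ℕ} {s : Finset ℕ} (hp : p < m)
    (hm : ∀ a ∈ s, m < a) (hs : s.Nonempty) :
    ∑ l ∈ arrangements (insert m s), weight x y (p :: l) =
      ∑ A ∈ s.powerset, lastFactor x y A.card *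
        (∑ l ∈ arrangements A, weight x y (p :: l)) *
        ∑ l ∈ arrangements (s \ A), weight x y (p :: l) := by
  rw [sum_arrangements_insert (fun h => lt_irrefl m (hm m h))]
  refine Finset.sum_congr rfl fun A hA => ?_
  rw [Finset.mem_powerset] at hA
  rw [mul_assoc, Finset.sum_mul_sum, Finset.mul_sum]
  simp_rw [Finset.mul_sum, ← mul_assoc]
  refine Finset.sum_congr rfl fun l₁ h₁ => Finset.sum_congr rfl fun l₂ h₂ => ?_
  have g₁ : ∀ a ∈ l₁, m < a := fun a ha => hm a (hA ((mem_of_mem_arrangements h₁).mp ha))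
  have g₂ : ∀ a ∈ l₂, m < a := fun a ha =>
    hm a (Finset.mem_sdiff.mp ((mem_of_mem_arrangements h₂).mp ha)).1
  rw [weight_append_cons x y hp g₁ g₂, length_of_mem_arrangements h₁,
    weight_cons_congr x y g₂ fun a ha => hp.trans (g₂ a ha)]
  -- If both pieces were empty, s would be empty.
  by_contra! h
  obtain ⟨rfl, rfl⟩ := h
  obtain ⟨a, ha⟩ := hs
  have e₁ := mem_of_mem_arrangements h₁ (a := a)
  have e₂ := mem_of_mem_arrangements h₂ (a := a)
  simp only [List.not_mem_nil, Finset.mem_sdiff, ha, true_and, false_iff, not_not] at e₁ e₂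
  exact e₁ e₂

theorem arrangements_empty : arrangements ∅ = {[]} := by
  ext l
  rw [mem_arrangements, List.toFinset_eq_empty_iff, Finset.mem_singleton]
  constructor
  · exact fun h => h.2
  · rintro rfl; simp

theorem arrangements_singleton (m : ℕ) : arrangements {m} = {[m]} := by
  ext l
  rw [mem_arrangements, Finset.mem_singleton]
  constructor
  · rintro ⟨h, e⟩
    have hl := List.toFinset_card_of_nodup h
    rw [e, Finset.card_singleton] at hl
    obtain ⟨a, rfl⟩ := List.length_eq_one_iff.mp hl.symm
    simpa using e
  · rintro rfl; simp

/-- Subsets of equal size contribute equally, whence the binomial coefficients. The extra 1 at n = 0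
is the one-letter word, which the factorisation at m misses. -/
theorem sum_weight_eq_sum_range (x y : K) {n m : ℕ} {s : Finset ℕ} (hm0 : 0 < m)
    (hm : ∀ a ∈ s, m < a) (hn : s.card = n)
    (ih : ∀ t ⊆ s, ∑ l ∈ arrangements t, weight x y (0 :: l) = totalWeight x y t.card) :
    ∑ l ∈ arrangements (insert m s), weight x y (0 :: l) =
      (if n = 0 then 1 else 0) + ∑ k ∈ Finset.range (n + 1), (n.choose k : K) *
        (lastFactor x y k * totalWeight x y k * totalWeight x y (n - k)) := by
  rcases s.eq_empty_or_nonempty with rfl | hs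
  · obtain rfl : n = 0 := by simpa using hn.symm
    simp [arrangements_singleton, weight, hm0, lastFactor]
  · have hn0 : n ≠ 0 := by rw [← hn]; exact hs.card_ne_zero
    rw [sum_weight_arrangements_insert x y hm0 hm hs, if_neg hn0, zero_add]
    have : ∀ A ∈ s.powerset, lastFactor x y A.card *
        (∑ l ∈ arrangements A, weight x y (0 :: l)) *
        ∑ l ∈ arrangements (s \ A), weight x y (0 :: l) =
        (fun k => lastFactor x y k * totalWeight x y k * totalWeight x y (n - k)) A.card := by
      intro A hA
      rw [Finset.mem_powerset] at hA
      rw [ih A hA, ih (s \ A) Finset.sdiff_subset, Finset.card_sdiff_of_subset hA, hn]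
    rw [Finset.sum_congr rfl this, Finset.sum_powerset_apply_card (fun k =>
      lastFactor x y k * totalWeight x y k * totalWeight x y (n - k)), hn]
    simp only [nsmul_eq_mul]

/-- The right side of the recursion depends only on the size of the set, so strong induction applies
it to s and to {1, …, n+1} alike; no order isomorphism is needed. -/
theorem sum_weight_eq_totalWeight (x y : K) (s : Finset ℕ) (hs : ∀ a ∈ s, 0 < a) :
    ∑ l ∈ arrangements s, weight x y (0 :: l) = totalWeight x y s.card := by
  obtain ⟨n, hn⟩ : ∃ n, s.card = n := ⟨_, rfl⟩
  induction n using Nat.strong_induction_on generalizing s with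
  | _ n ih =>
    cases n with
    | zero =>
      obtain rfl := Finset.card_eq_zero.mp hn
      simp [totalWeight]
    | succ n =>
      have key : ∀ t : Finset ℕ, (∀ a ∈ t, 0 < a) → t.card = n + 1 →
          ∑ l ∈ arrangements t, weight x y (0 :: l) =
          (if n = 0 then 1 else 0) + ∑ k ∈ Finset.range (n + 1), (n.choose k : K) *
            (lastFactor x y k * totalWeight x y k * totalWeight x y (n - k)) := by
        intro t ht hc
        have hne : t.Nonempty := Finset.card_pos.mp (by omega)
        have hmem := t.min'_mem hne
        have hcard : (t.erase (t.min' hne)).card = n := by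
          rw [Finset.card_erase_of_mem hmem]; omega
        have h := sum_weight_eq_sum_range x y (m := t.min' hne) (s := t.erase (t.min' hne))
          (ht _ hmem) (fun a ha => t.min'_lt_of_mem_erase_min' hne ha) hcard (fun u hu =>
            ih u.card (by have := Finset.card_le_card hu; omega) u
              (fun a ha => ht a (Finset.mem_of_mem_erase (hu ha))) rfl)
        rwa [Finset.insert_erase hmem] at h
      rw [key s hs hn, hn, totalWeight, key _ (fun a ha => (Finset.mem_Icc.mp ha).1) (by simp)]

theorem totalWeight_zero (x y : K) : totalWeight x y 0 = 1 := by
  simp [totalWeight, arrangements_empty, weight]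

theorem totalWeight_succ (x y : K) (n : ℕ) :
    totalWeight x y (n + 1) =
      (if n = 0 then 1 else 0) + ∑ k ∈ Finset.range (n + 1), (n.choose k : K) *
        (lastFactor x y k * totalWeight x y k * totalWeight x y (n - k)) := by
  have h : Finset.Icc 1 (n + 1) = insert 1 (Finset.Icc 2 (n + 1)) := by
    ext a; simp only [Finset.mem_Icc, Finset.mem_insert]; omega
  rw [totalWeight, h]
  refine sum_weight_eq_sum_range x y one_pos (fun a ha => ?_) (by simp) fun t ht =>
    sum_weight_eq_totalWeight x y t fun a ha => ?_
  · have := Finset.mem_Icc.mp ha; omega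
  · have := Finset.mem_Icc.mp (ht ha); omega

end Words

/-! ### From permutations and their peak counts to weighted words. -/

section Permutations

/-- The word `w 0, …, w n` goes up-down-up-⋯. -/
def IsUpDown (w : ℕ → ℕ) (n : ℕ) : Prop :=
  ∀ i, i + 1 ≤ n → (Even i → w i < w (i + 1)) ∧ (Odd i → w (i + 1) < w i)

/-- The peaks of the word `w 0, …, w n` whose two neighbours are related by `r`. -/
def peakSet (r : ℕ → ℕ → Prop) (w : ℕ → ℕ) (n : ℕ) : Set ℕ :=
  {i | (1 ≤ i ∧ i + 1 ≤ n) ∧ (w (i - 1) < w i ∧ w (i + 1) < w i) ∧ r (w (i - 1)) (w (i + 1))}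

theorem peakSet_subset (r : ℕ → ℕ → Prop) (w : ℕ → ℕ) (n : ℕ) :
    peakSet r w n ⊆ (Finset.Icc 1 n : Finset ℕ) := by
  rintro i ⟨h, -⟩
  rw [Finset.mem_coe, Finset.mem_Icc]
  omega

theorem ncard_peakSet_le (r : ℕ → ℕ → Prop) (w : ℕ → ℕ) (n : ℕ) :
    (peakSet r w n).ncard ≤ n := by
  refine (Set.ncard_le_ncard (peakSet_subset r w n) (Finset.finite_toSet _)).trans ?_
  rw [Set.ncard_coe_finset]
  simp

theorem peakSet_eq_empty (r : ℕ → ℕ → Prop) (w : ℕ → ℕ) {n : ℕ} (hn : n ≤ 1) :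
    peakSet r w n = ∅ := by
  ext i
  simp only [peakSet, Set.mem_ofPred_eq, Set.mem_empty_iff_false, iff_false]
  omega

open Classical in
theorem ncard_setOf_eq_add {P : ℕ → Prop} (hP : {i | P i}.Finite) :
    {i | P i}.ncard = (if P 0 then 1 else 0) + {i | P (i + 1)}.ncard := by
  have hinj : Function.Injective (fun i : ℕ => i + 1) := fun a b h => by simpa using h
  have himg : ((fun i => i + 1) '' {i | P (i + 1)}).ncard = {i | P (i + 1)}.ncard :=
    Set.ncard_image_of_injective _ hinj
  have hsub : (fun i => i + 1) '' {i | P (i + 1)} ⊆ {i | P i} := by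
    rintro _ ⟨i, hi, rfl⟩; exact hi
  split_ifs with h0
  · have : {i | P i} = insert 0 ((fun i => i + 1) '' {i | P (i + 1)}) := by
      ext i
      cases i <;> simp [h0]
    rw [this, Set.ncard_insert_of_notMem (by simp) (hP.subset hsub), himg, add_comm]
  · have : {i | P i} = (fun i => i + 1) '' {i | P (i + 1)} := by
      ext i
      cases i <;> simp [h0]
    rw [this, himg, zero_add]

theorem isUpDown_add_two (w : ℕ → ℕ) (n : ℕ) :
    IsUpDown w (n + 2) ↔ (w 0 < w 1 ∧ w 2 < w 1) ∧ IsUpDown (fun i => w (i + 2)) n := by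
  constructor
  · intro h
    refine ⟨⟨(h 0 (by omega)).1 (by simp), (h 1 (by omega)).2 (by simp)⟩, fun i hi => ?_⟩
    have := h (i + 2) (by omega)
    simpa [parity_simps] using this
  · rintro ⟨h, h'⟩ i hi
    match i with
    | 0 => simpa using h.1
    | 1 => simpa using h.2
    | i + 2 => simpa [parity_simps] using h' i (by omega)

-- Index 1 is a peak, indices 0 and 2 are not, and the others are peaks of the word shifted by two.
open Classical in
theorem ncard_peakSet_add_two (r : ℕ → ℕ → Prop) (w : ℕ → ℕ) (n : ℕ)
    (h : w 0 < w 1 ∧ w 2 < w 1) :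
    (peakSet r w (n + 2)).ncard =
      (if r (w 0) (w 2) then 1 else 0) + (peakSet r (fun i => w (i + 2)) n).ncard := by
  have hfin : (peakSet r w (n + 2)).Finite :=
    (Finset.finite_toSet _).subset (peakSet_subset r w (n + 2))
  have hinj : Function.Injective (fun i : ℕ => i + 1) := fun a b h => by simpa using h
  have e₀ := ncard_setOf_eq_add (P := fun i => i ∈ peakSet r w (n + 2)) hfin
  have e₁ := ncard_setOf_eq_add (P := fun i => i + 1 ∈ peakSet r w (n + 2))
    (hfin.preimage hinj.injOn)
  have h₀ : 0 ∉ peakSet r w (n + 2) := fun h' => absurd h'.1.1 (by simp)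
  have h₁ : 0 + 1 ∈ peakSet r w (n + 2) ↔ r (w 0) (w 2) := by
    simp [peakSet, h.1, h.2]
  rw [e₁, if_neg h₀, zero_add] at e₀
  simp only [h₁] at e₀
  refine e₀.trans ?_
  congr 2
  ext i
  cases i with
  | zero => simpa [peakSet] using fun _ h' => absurd h' h.2.le.not_gt
  | succ i =>
    simp [peakSet]

open Classical in
theorem weight_eq_ite {K : Type*} [Field K] (x y : K) : ∀ (l : List ℕ) (p : ℕ),
    weight x y (p :: l) =
      if IsUpDown (fun i => (p :: l).getD i 0) l.length then
        x ^ (peakSet (· < ·) (fun i => (p :: l).getD i 0) l.length).ncard *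
          y ^ (peakSet (fun a b => b < a) (fun i => (p :: l).getD i 0) l.length).ncard
      else 0
  | [], p => by
    simp [weight, IsUpDown, peakSet_eq_empty]
  | [a], p => by
    have h : IsUpDown (fun i => [p, a].getD i 0) 1 ↔ p < a := by
      constructor
      · intro h
        simpa using (h 0 le_rfl).1
      · intro h i hi
        obtain rfl : i = 0 := by omega
        simpa using h
    simp only [weight, List.length_singleton, h, peakSet_eq_empty _ _ le_rfl]
    simp
  | a :: b :: l, p => by
    have ih := weight_eq_ite x y l b
    have h := isUpDown_add_two (fun i => (p :: a :: b :: l).getD i 0) l.length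
    have h₁ := ncard_peakSet_add_two (· < ·) (fun i => (p :: a :: b :: l).getD i 0) l.length
    have h₂ := ncard_peakSet_add_two (fun a b => b < a)
      (fun i => (p :: a :: b :: l).getD i 0) l.length
    simp only [List.getD_cons_succ, List.getD_cons_zero] at h h₁ h₂
    simp only [weight, List.length_cons]
    by_cases hp : p < a ∧ b < a
    · rw [if_pos hp, h₁ hp, h₂ hp, ih]
      simp only [h, hp, and_self, true_and, pow_add]
      rcases lt_trichotomy p b with hb | rfl | hb
      -- The three cases are pattern 132, a tie, which contributes 1 and no peak to either set, and
      -- pattern 231.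
      · simp [hb, hb.le.not_gt, mul_assoc]
      · simp
      · simp [hb, hb.le.not_gt, mul_left_comm]
    · rw [if_neg hp, if_neg fun h' => hp (h.mp h').1]

/-- The list `π₁, …, πₙ`. -/
def wordList {n : ℕ} (σ : Equiv.Perm (Fin n)) : List ℕ :=
  List.ofFn fun i => (σ i : ℕ) + 1

theorem word_eq_getD {n : ℕ} (σ : Equiv.Perm (Fin n)) :
    word σ = fun i => (0 :: wordList σ).getD i 0 := by
  funext i
  cases i with
  | zero => simp [word]
  | succ i =>
    by_cases h : i < n
    · simp [word, wordList, List.getD_eq_getElem?_getD, Nat.succ_le_of_lt h]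
    · simp [word, wordList, List.getD_eq_getElem?_getD, h]

/-- Prepending π₀ = 0 adds only an initial ascent, which is automatic as all entries are positive.
-/
theorem isAlternating_iff {n : ℕ} (σ : Equiv.Perm (Fin n)) :
    IsAlternating σ ↔ IsUpDown (word σ) n := by
  constructor
  · intro h i hi
    rcases Nat.eq_zero_or_pos i with rfl | h0
    · have : 0 < word σ 1 := by
        rw [word, dif_pos ⟨le_rfl, hi⟩]
        exact Nat.succ_pos _
      simpa [word] using this
    · exact (h i h0 hi).symm
  · intro h i _ hi
    exact (h i hi).symm

theorem ep132_eq {n : ℕ} (σ : Equiv.Perm (Fin n)) :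
    ep132 σ = (peakSet (· < ·) (word σ) n).ncard := by
  simp only [ep132, peakSet, IsExteriorPeak, and_assoc]

theorem ep231_eq {n : ℕ} (σ : Equiv.Perm (Fin n)) :
    ep231 σ = (peakSet (fun a b => b < a) (word σ) n).ncard := by
  simp only [ep231, peakSet, IsExteriorPeak, and_assoc]

open Classical in
theorem altPoly_eq_sum {K : Type*} [Field K] (n : ℕ) (x y : K) :
    altPoly n x y =
      ∑ σ : Equiv.Perm (Fin n), if IsAlternating σ then x ^ ep132 σ * y ^ ep231 σ else 0 := by
  have hcount : ∀ i j, (altCount n i j : K) * x ^ i * y ^ j =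
      ∑ σ : Equiv.Perm (Fin n), if IsAlternating σ then
        (if ep132 σ = i then (if ep231 σ = j then x ^ i * y ^ j else 0) else 0) else 0 := by
    intro i j
    rw [altCount, Set.ncard_eq_toFinset_card', Set.toFinset_ofPred]
    simp_rw [← ite_and]
    rw [← Finset.sum_filter, Finset.sum_const, nsmul_eq_mul, mul_assoc]
  have h₁ : ∀ σ : Equiv.Perm (Fin n), ep132 σ ∈ Finset.range (n + 1) := fun σ => by
    rw [Finset.mem_range, ep132_eq, Nat.lt_succ_iff]; exact ncard_peakSet_le _ _ _
  have h₂ : ∀ σ : Equiv.Perm (Fin n), ep231 σ ∈ Finset.range (n + 1) := fun σ => by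
    rw [Finset.mem_range, ep231_eq, Nat.lt_succ_iff]; exact ncard_peakSet_le _ _ _
  simp_rw [altPoly, hcount]
  simp_rw [Finset.sum_comm (s := Finset.range (n + 1)) (t := Finset.univ)]
  refine Finset.sum_congr rfl fun σ _ => ?_
  by_cases h : IsAlternating σ
  · simp only [h, if_true]
    rw [Finset.sum_eq_single_of_mem _ (h₁ σ), Finset.sum_eq_single_of_mem _ (h₂ σ)]
    · simp
    · intro j _ hj; simp [hj.symm]
    · intro i _ hi; simp [hi.symm]
  · simp [h]

theorem altPoly_one_one {K : Type*} [Field K] (n : ℕ) :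
    altPoly n (1 : K) 1 = (eulerNumber n : K) := by
  classical
  rw [altPoly_eq_sum, eulerNumber, Set.ncard_eq_toFinset_card', Set.toFinset_ofPred]
  simp

theorem sum_wordList {M : Type*} [AddCommMonoid M] (n : ℕ) (f : List ℕ → M) :
    ∑ σ : Equiv.Perm (Fin n), f (wordList σ) = ∑ l ∈ arrangements (Finset.Icc 1 n), f l := by
  refine Finset.sum_bij (fun σ _ => wordList σ) ?_ ?_ ?_ fun _ _ => rfl
  · intro σ _
    rw [mem_arrangements]
    constructor
    · rw [wordList, List.nodup_ofFn]
      intro i j h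
      exact σ.injective (Fin.ext (by simpa using h))
    · ext a
      simp only [wordList, List.mem_toFinset, List.mem_ofFn, Finset.mem_Icc]
      constructor
      · rintro ⟨i, rfl⟩
        have := (σ i).isLt
        omega
      · rintro ⟨h1, h2⟩
        exact ⟨σ.symm ⟨a - 1, by omega⟩, by simp; omega⟩
  · intro σ _ τ _ h
    ext i
    have := congrFun (List.ofFn_injective h) i
    simpa using this
  · intro l hl
    have hlen : l.length = n := by rw [length_of_mem_arrangements hl]; simp
    obtain ⟨hn, he⟩ := mem_arrangements.mp hl
    have hmem : ∀ (i : ℕ) (hi : i < l.length), 1 ≤ l[i] ∧ l[i] ≤ n := fun i hi =>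
      Finset.mem_Icc.mp ((mem_of_mem_arrangements hl).mp (List.getElem_mem hi))
    let g : Fin n → Fin n := fun i =>
      ⟨l[i.1]'(by omega) - 1, by have := hmem i.1 (by omega); omega⟩
    have hg : Function.Injective g := by
      intro i j h
      have hi := hmem i.1 (by omega)
      have hj := hmem j.1 (by omega)
      have h' : l[i.1]'(by omega) - 1 = l[j.1]'(by omega) - 1 := congrArg Fin.val h
      exact Fin.ext ((List.Nodup.getElem_inj_iff hn).mp (by omega))
    refine ⟨Equiv.ofBijective g (Finite.injective_iff_bijective.mp hg), Finset.mem_univ _, ?_⟩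
    apply List.ext_getElem
    · simp [wordList, hlen]
    · intro i h1 h2
      have := hmem i h2
      simp only [wordList, List.getElem_ofFn, Equiv.ofBijective_apply, g]
      omega

theorem altPoly_eq_totalWeight {K : Type*} [Field K] (n : ℕ) (x y : K) :
    altPoly n x y = totalWeight x y n := by
  classical
  rw [altPoly_eq_sum, totalWeight, ← sum_wordList n fun l => weight x y (0 :: l)]
  refine Finset.sum_congr rfl fun σ _ => ?_
  rw [weight_eq_ite, ← word_eq_getD, ep132_eq, ep231_eq, isAlternating_iff,
    show (wordList σ).length = n by simp [wordList]]

end Permutations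

/-! ### From the recursion to the generating function. -/

section GeneratingFunction

open PowerSeries

variable {K : Type*} [Field K]

theorem totalWeight_one (x y : K) : totalWeight x y 1 = 1 := by
  simp [totalWeight_succ, lastFactor]

variable [CharZero K]

theorem derivative_mk_div_factorial (a : ℕ → K) :
    d⁄dX K (PowerSeries.mk fun n => a n / (n ! : K)) =
      PowerSeries.mk fun n => a (n + 1) / (n ! : K) := by
  ext n
  have h1 : (n : K) + 1 ≠ 0 := by exact_mod_cast n.succ_ne_zero
  have h2 : (n ! : K) ≠ 0 := by exact_mod_cast n.factorial_ne_zero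
  rw [coeff_derivative, coeff_mk, coeff_mk, Nat.factorial_succ]
  push_cast
  field_simp

theorem mk_div_factorial_mul (a b : ℕ → K) :
    (PowerSeries.mk fun n => a n / (n ! : K)) * (PowerSeries.mk fun n => b n / (n ! : K)) =
      PowerSeries.mk fun n =>
        (∑ k ∈ Finset.range (n + 1), (n.choose k : K) * (a k * b (n - k))) / (n ! : K) := by
  ext n
  rw [coeff_mul, coeff_mk, Finset.Nat.sum_antidiagonal_eq_sum_range_succ_mk, Finset.sum_div]
  refine Finset.sum_congr rfl fun k hk => ?_
  have hk' : k ≤ n := Nat.lt_succ_iff.mp (Finset.mem_range.mp hk)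
  have h1 : (n ! : K) ≠ 0 := by exact_mod_cast n.factorial_ne_zero
  have h2 : (k ! : K) ≠ 0 := by exact_mod_cast k.factorial_ne_zero
  have h3 : ((n - k)! : K) ≠ 0 := by exact_mod_cast (n - k).factorial_ne_zero
  rw [coeff_mk, coeff_mk, Nat.cast_choose K hk']
  field_simp

/-- The exponential generating function of the polynomials `T^A_n(x, y)` in terms of a solution of
`P'' + (x-y)t P' + y P = 0`. -/
theorem mk_altPoly_eq {x y : K} {N P : PowerSeries K}
    (hP : d⁄dX K P = N) (hP0 : constantCoeff P = 0)
    (hN : d⁄dX K N = -(C (x - y) * X * N) - C y * P) (hN0 : constantCoeff N = 1) :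
    (PowerSeries.mk fun n => altPoly n x y / (n ! : K)) = (1 + P) * N⁻¹ := by
  simp_rw [altPoly_eq_totalWeight]
  set o : ℕ → K := fun n => if Odd n then totalWeight x y n else 0 with ho
  set v : ℕ → K := fun n => lastFactor x y n * totalWeight x y n with hv
  -- `lastFactor` is y at every odd k except k = 1, where x = y + (x-y); as T₁ = 1, the correction
  -- is (x-y)t.
  have hH : (PowerSeries.mk fun n => v n / (n ! : K)) =
      C y * (PowerSeries.mk fun n => o n / (n ! : K)) + C (x - y) * X := by
    ext n
    rw [map_add, coeff_C_mul, coeff_C_mul, coeff_X, coeff_mk, coeff_mk]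
    by_cases h1 : n = 1
    · subst h1
      simp [hv, ho, lastFactor, totalWeight_one]
    · by_cases h2 : Odd n <;> simp [hv, ho, lastFactor, h1, h2, mul_div_assoc]
  have hone : (1 : PowerSeries K) =
      PowerSeries.mk fun n => (if n = 0 then 1 else 0) / (n ! : K) := by
    ext n
    rw [coeff_one, coeff_mk]
    split_ifs with h <;> simp [h]
  refine eq_one_add_mul_inv_of_derivative
    (O := PowerSeries.mk fun n => o n / (n ! : K)) ?_ ?_ ?_ ?_ hP hP0 hN hN0
  · rw [← hH, derivative_mk_div_factorial, mk_div_factorial_mul, hone]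
    ext n
    rw [map_add, coeff_mk, coeff_mk, coeff_mk, totalWeight_succ, add_div]
  · rw [← coeff_zero_eq_constantCoeff_apply]
    simp [totalWeight_zero]
  · rw [← hH, derivative_mk_div_factorial, mk_div_factorial_mul, hone]
    ext n
    rw [map_add, coeff_mk, coeff_mk, coeff_mk, ← add_div]
    congr 1
    -- Only odd k contribute, so n - k is odd exactly when n + 1 is: the recursion restricts to odd
    -- indices.
    by_cases hn : Odd (n + 1)
    · rw [ho]
      simp only [hn, if_true, totalWeight_succ]
      congr 1
      refine Finset.sum_congr rfl fun k hk => ?_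
      have hk' : k ≤ n := Nat.lt_succ_iff.mp (Finset.mem_range.mp hk)
      by_cases hko : Odd k
      · have : Odd (n - k) := by
          rw [Nat.odd_iff] at *
          omega
        simp [hv, this]
      · have : k ≠ 1 := by rintro rfl; simp at hko
        simp [hv, lastFactor, hko, this]
    · have hn0 : n ≠ 0 := by rintro rfl; simp at hn
      rw [if_neg hn0, zero_add, Finset.sum_eq_zero]
      · simp [ho, hn]
      · intro k hk
        have hk' : k ≤ n := Nat.lt_succ_iff.mp (Finset.mem_range.mp hk)
        by_cases hko : Odd k
        · have : ¬ Odd (n - k) := by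
            rw [Nat.odd_iff] at *
            omega
          simp [ho, this]
        · have : k ≠ 1 := by rintro rfl; simp at hko
          simp [hv, lastFactor, hko, this]
  · rw [← coeff_zero_eq_constantCoeff_apply]
    simp [ho]

theorem mk_altPoly_eq_closedForm {x y : K} (hxy : x ≠ y) :
    (PowerSeries.mk fun n => altPoly n x y / (n ! : K)) = closedForm x y := by
  obtain ⟨N, P, hP, hP0, hN, hN0, h⟩ := closedForm_eq x y hxy
  rw [h, mk_altPoly_eq hP hP0 hN hN0]

theorem mk_altPoly_one_one :
    (PowerSeries.mk fun n => altPoly n (1 : K) 1 / (n ! : K)) =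
      (PowerSeries.cos K)⁻¹ + PowerSeries.sin K * (PowerSeries.cos K)⁻¹ := by
  rw [mk_altPoly_eq (N := PowerSeries.cos K) (P := PowerSeries.sin K) derivative_sin, add_mul,
    one_mul]
  · rw [← coeff_zero_eq_constantCoeff_apply]
    simp [PowerSeries.sin]
  · simp [derivative_cos]
  · rw [← coeff_zero_eq_constantCoeff_apply]
    simp [PowerSeries.cos]

end GeneratingFunction

end AltPeaks

theorem mainTheorem7 :
    -- the generating function, as an identity of formal power series in `t`
    (∀ (K : Type*) [Field K] [CharZero K] (x y : K), x ≠ y →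
      PowerSeries.mk (fun n => AltPeaks.altPoly n x y / (n ! : K)) = AltPeaks.closedForm x y) ∧
    -- the specialization `x, y → 1`, coefficient by coefficient in `t`
    (∀ n : ℕ, Filter.Tendsto
      (fun p : ℂ × ℂ => PowerSeries.coeff n (AltPeaks.closedForm p.1 p.2))
      (𝓝[{p : ℂ × ℂ | p.1 ≠ p.2}] (1, 1))
      (𝓝 (PowerSeries.coeff n
        ((PowerSeries.cos ℂ)⁻¹ + PowerSeries.sin ℂ * (PowerSeries.cos ℂ)⁻¹)))) ∧
    -- at `x = y = 1` one counts all alternating permutations: `∑ Eₙ tⁿ / n! = sec t + tan t`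
    (∀ n : ℕ, AltPeaks.altPoly n (1 : ℂ) 1 = (AltPeaks.eulerNumber n : ℂ)) ∧
    PowerSeries.mk (fun n => (AltPeaks.eulerNumber n : ℂ) / (n ! : ℂ)) =
      (PowerSeries.cos ℂ)⁻¹ + PowerSeries.sin ℂ * (PowerSeries.cos ℂ)⁻¹ := by
  refine ⟨fun K _ _ x y hxy => AltPeaks.mk_altPoly_eq_closedForm hxy, fun n => ?_,
    AltPeaks.altPoly_one_one, ?_⟩
  -- Off the diagonal each coefficient of the closed form is a polynomial in x and y, which is
  -- continuous at (1, 1).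
  · rw [← AltPeaks.mk_altPoly_one_one, PowerSeries.coeff_mk]
    have hcont : Continuous fun p : ℂ × ℂ => AltPeaks.altPoly n p.1 p.2 / (n ! : ℂ) := by
      unfold AltPeaks.altPoly
      fun_prop
    refine (hcont.continuousAt.tendsto.mono_left nhdsWithin_le_nhds).congr' ?_
    filter_upwards [self_mem_nhdsWithin] with p hp
    rw [← AltPeaks.mk_altPoly_eq_closedForm hp, PowerSeries.coeff_mk]
  · simp_rw [← AltPeaks.altPoly_one_one (K := ℂ)]
    exact AltPeaks.mk_altPoly_one_one
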